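/- Let $M$ be a compact smooth $3$-manifold (without boundary), and let $(\omega,T)$, $(\tilde\omega,\tilde T)$ be pairs consisting of a smooth $1$-form and a smooth vector field on $M$ with $\omega(T)=1=\tilde\omega(\tilde T)$. Put $\eta=\iota_T\,d\omega$ and $\tilde\eta=\iota_{\tilde T}\,d\tilde\omega$. (Conventions: $d\alpha(X,Y)=X(\alpha(Y))-Y(\alpha(X))-\alpha([X,Y])$, $\iota_Z\alpha=\alpha(Z,\cdot)$, and $(\alpha\wedge\beta)(X,Y)=\alpha(X)\beta(Y)-\alpha(Y)\beta(X)$ for $1$-forms.) (0) Let $g$ be any Riemannian metric on $M$ compatible with $(\omega,T)$, i.e. $\omega(Y)=g(T,Y)$ for all $Y$. Then $\eta$ is the unique $1$-form with $\eta\perp\omega$ such that $\omega\wedge\eta$ is the $g$-orthogonal projection of $d\omega$ onto $\omega\wedge\omega^\perp$, that is, such that $d\omega-\omega\wedge\eta$ is orthogonal to $\omega\wedge\theta$ for all $\theta\perp\omega$. (i) If $\tilde T=e^{-f}T$ for a smooth function $f$ on $M$ and $\tilde\omega$ is pointwise a multiple of $\omega$, then $\tilde\omega=e^f\omega$, $\tilde\eta=\eta-df+T(f)\,\omega$,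 and $$\tilde\eta\wedge d\tilde\eta=\eta\wedge d\eta+d\alpha+2\,T(f)\,\omega\wedge d\eta+T(f)^2\,\omega\wedge d\omega,$$ where $\alpha$ is the $2$-form $\alpha=-f\,d\eta-f\,d(T(f)\,\omega)+T(f)\,\omega\wedge\eta$. (ii) If $\tilde T=T+X$ for a smooth vector field $X$ with $\omega(X)=0$, and $\tilde\omega=\omega$, then $\tilde\eta=\eta+\iota_X d\omega$ and $$\tilde\eta\wedge d\tilde\eta=\eta\wedge d\eta-d(\eta\wedge\iota_Xd\omega)+2\,d\eta\wedge\iota_Xd\omega+\iota_Xd\omega\wedge d(\iota_Xd\omega).$$ (iii) If $\tilde T=T$ and $\tilde\omega=\omega+\mu$ for a smooth $1$-form $\mu$, then $\mu(T)=0$, $\tilde\eta=\eta+\iota_Td\mu$ and $$\tilde\eta\wedge d\tilde\eta=\eta\wedge d\eta-d(\eta\wedge\iota_Td\mu)+2\,d\eta\wedge\iota_Td\mu+\iota_Td\mu\wedge d(\iota_Td\mu).$$ -/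

import Mathlib

open scoped Manifold Nat

/-- The order of smoothness `C^∞` (not analytic). -/
local notation "∞" => ((⊤ : ℕ∞) : WithTop ℕ∞)

noncomputable section

/-! ### Exterior algebra on one (topological) vector space -/

section Algebra

variable {V : Type*} [AddCommGroup V] [Module ℝ V] [TopologicalSpace V] {k l : ℕ}

/-- The multilinear form `(v₁, …, v_{k+l}) ↦ α (v₁, …, v_k) * β (v_{k+1}, …, v_{k+l})`. -/
def altTensor (α : V [⋀^Fin k]→L[ℝ] ℝ) (β : V [⋀^Fin l]→L[ℝ] ℝ) :
    ContinuousMultilinearMap ℝ (fun _ : Fin (k + l) => V) ℝ where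
  toFun v := α (fun i => v (Fin.castAdd l i)) * β (fun j => v (Fin.natAdd k j))
  map_update_add' := by
    intro inst v i x y
    obtain rfl : inst = instDecidableEqFin (k + l) := Subsingleton.elim _ _
    refine Fin.addCases (fun i => ?_) (fun j => ?_) i
    · have h1 : ∀ z : V, (fun a => Function.update v (Fin.castAdd l i) z (Fin.castAdd l a))
          = Function.update (fun a => v (Fin.castAdd l a)) i z := fun z =>
        Function.update_comp_eq_of_injective v (Fin.castAdd_injective k l) i z
      have h2 : ∀ z : V, (fun b => Function.update v (Fin.castAdd l i) z (Fin.natAdd k b))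
          = fun b => v (Fin.natAdd k b) := fun z => by
        funext b
        refine Function.update_of_ne (fun h => ?_) _ _
        have := congrArg Fin.val h
        simp at this
        omega
      simp only [h1, h2, ContinuousAlternatingMap.map_update_add, add_mul]
    · have h1 : ∀ z : V, (fun b => Function.update v (Fin.natAdd k j) z (Fin.natAdd k b))
          = Function.update (fun b => v (Fin.natAdd k b)) j z := fun z =>
        Function.update_comp_eq_of_injective v (Fin.natAdd_injective l k) j z
      have h2 : ∀ z : V, (fun a => Function.update v (Fin.natAdd k j) z (Fin.castAdd l a))
          = fun a => v (Fin.castAdd l a) := fun z => by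
        funext a
        refine Function.update_of_ne (fun h => ?_) _ _
        have := congrArg Fin.val h
        simp at this
        omega
      simp only [h1, h2, ContinuousAlternatingMap.map_update_add, mul_add]
  map_update_smul' := by
    intro inst v i c x
    obtain rfl : inst = instDecidableEqFin (k + l) := Subsingleton.elim _ _
    refine Fin.addCases (fun i => ?_) (fun j => ?_) i
    · have h1 : ∀ z : V, (fun a => Function.update v (Fin.castAdd l i) z (Fin.castAdd l a))
          = Function.update (fun a => v (Fin.castAdd l a)) i z := fun z =>
        Function.update_comp_eq_of_injective v (Fin.castAdd_injective k l) i z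
      have h2 : ∀ z : V, (fun b => Function.update v (Fin.castAdd l i) z (Fin.natAdd k b))
          = fun b => v (Fin.natAdd k b) := fun z => by
        funext b
        refine Function.update_of_ne (fun h => ?_) _ _
        have := congrArg Fin.val h
        simp at this
        omega
      simp only [h1, h2, ContinuousAlternatingMap.map_update_smul, smul_eq_mul, mul_assoc]
    · have h1 : ∀ z : V, (fun b => Function.update v (Fin.natAdd k j) z (Fin.natAdd k b))
          = Function.update (fun b => v (Fin.natAdd k b)) j z := fun z =>
        Function.update_comp_eq_of_injective v (Fin.natAdd_injective l k) j z
      have h2 : ∀ z : V, (fun a => Function.update v (Fin.natAdd k j) z (Fin.castAdd l a))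
          = fun a => v (Fin.castAdd l a) := fun z => by
        funext a
        refine Function.update_of_ne (fun h => ?_) _ _
        have := congrArg Fin.val h
        simp at this
        omega
      simp only [h1, h2, ContinuousAlternatingMap.map_update_smul, smul_eq_mul, mul_left_comm]
  cont := (α.cont.comp (continuous_pi fun _ => continuous_apply _)).mul
    (β.cont.comp (continuous_pi fun _ => continuous_apply _))

/-- The wedge product of alternating forms, normalised so that
`(α ∧ β)(v, w) = α v * β w - α w * β v` for one-forms:
`α ∧ β = 1 / (k! l!) ∑_σ sign σ • (α ⊗ β) ∘ σ`. -/
def altWedge (α : V [⋀^Fin k]→L[ℝ] ℝ) (β : V [⋀^Fin l]→L[ℝ] ℝ) : V [⋀^Fin (k + l)]→L[ℝ] ℝ :=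
  ((k ! : ℝ) * (l ! : ℝ))⁻¹ • ContinuousMultilinearMap.alternatization (altTensor α β)

/-- The interior product: `(ι_v α)(w₁, …, w_k) = α (v, w₁, …, w_k)`. -/
def altInterior (v : V) (α : V [⋀^Fin (k + 1)]→L[ℝ] ℝ) : V [⋀^Fin k]→L[ℝ] ℝ :=
  { α.toAlternatingMap.curryLeft v with
    cont := α.cont.comp (continuous_const.matrixVecCons continuous_id) }

end Algebra

/-! ### Vector fields and differential forms on a manifold modelled on `E`, without boundary -/

section Forms

variable {E : Type*} [NormedAddCommGroup E] [NormedSpace ℝ E]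

/-- A (not necessarily smooth) differential `k`-form on `M`. -/
abbrev DForm (E : Type*) [NormedAddCommGroup E] [NormedSpace ℝ E] (M : Type*)
    [TopologicalSpace M] [ChartedSpace E M] (k : ℕ) : Type _ :=
  ∀ x : M, TangentSpace 𝓘(ℝ, E) x [⋀^Fin k]→L[ℝ] ℝ

/-- A (not necessarily smooth) vector field on `M`. -/
abbrev VField (E : Type*) [NormedAddCommGroup E] [NormedSpace ℝ E] (M : Type*)
    [TopologicalSpace M] [ChartedSpace E M] : Type _ :=
  ∀ x : M, TangentSpace 𝓘(ℝ, E) x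

variable {M : Type*} [TopologicalSpace M] [ChartedSpace E M] {k l : ℕ}

/-- A vector field is smooth if it is a smooth section of the tangent bundle. -/
def VField.IsSmooth [IsManifold 𝓘(ℝ, E) ∞ M] (X : VField E M) : Prop :=
  ContMDiff 𝓘(ℝ, E) 𝓘(ℝ, E).tangent ∞
    (fun x => (⟨x, X x⟩ : TangentBundle 𝓘(ℝ, E) M))

/-- The expression of a `k`-form in the chart `φ` at `x₀`, i.e. its pull-back by `φ⁻¹`
(meaningful on the target of `φ`). -/
def DForm.inChart (ω : DForm E M k) (x₀ : M) : E → E [⋀^Fin k]→L[ℝ] ℝ := fun y =>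
  (ω ((chartAt E x₀).symm y)).compContinuousLinearMap
    (mfderiv 𝓘(ℝ, E) 𝓘(ℝ, E) (chartAt E x₀).symm y :
      E →L[ℝ] TangentSpace 𝓘(ℝ, E) ((chartAt E x₀).symm y))

/-- A form is smooth if its coefficients are smooth in the charts. -/
def DForm.IsSmooth (ω : DForm E M k) : Prop :=
  ∀ x₀ : M, ContDiffOn ℝ ∞ (ω.inChart x₀) (chartAt E x₀).target

/-- The exterior derivative, computed at `x` in the chart at `x`. -/
def DForm.d (ω : DForm E M k) : DForm E M (k + 1) := fun x =>
  (extDeriv (ω.inChart x) (chartAt E x x)).compContinuousLinearMap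
    (mfderiv 𝓘(ℝ, E) 𝓘(ℝ, E) (chartAt E x) x : TangentSpace 𝓘(ℝ, E) x →L[ℝ] E)

/-- The wedge product of forms. -/
def DForm.wedge (α : DForm E M k) (β : DForm E M l) : DForm E M (k + l) :=
  fun x => altWedge (α x) (β x)

/-- The interior product `ι_X α`. -/
def DForm.interior (X : VField E M) (α : DForm E M (k + 1)) : DForm E M k :=
  fun x => altInterior (X x) (α x)

/-- The product of a function and a form. -/
def DForm.mulFun (h : M → ℝ) (α : DForm E M k) : DForm E M k := fun x => h x • α x

/-- The function `ω(X)`, for a one-form `ω` and a vector field `X`. -/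
def DForm.pair (ω : DForm E M 1) (X : VField E M) : M → ℝ := fun x => ω x ![X x]

/-- The differential `df` of a function, as a one-form. -/
def funDiff (f : M → ℝ) : DForm E M 1 := fun x =>
  ContinuousAlternatingMap.ofSubsingleton ℝ (TangentSpace 𝓘(ℝ, E) x) ℝ (0 : Fin 1)
    (mfderiv 𝓘(ℝ, E) 𝓘(ℝ, ℝ) f x : TangentSpace 𝓘(ℝ, E) x →L[ℝ] ℝ)

/-- The derivative `X(f)` of a function `f` along a vector field `X`. -/
def VField.deriv (X : VField E M) (f : M → ℝ) : M → ℝ := DForm.pair (funDiff f) X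

/-- The one-form `η = ι_T dω` of a pair `(ω, T)`. -/
def gvForm (ω : DForm E M 1) (T : VField E M) : DForm E M 1 := ω.d.interior T

end Forms

/-! ### Metric description of `η` on 3-manifolds -/

section Metric

/-- The model space of 3-manifolds. -/
abbrev R3 : Type := EuclideanSpace ℝ (Fin 3)

variable {M : Type*} [TopologicalSpace M] [ChartedSpace R3 M] [IsManifold 𝓘(ℝ, R3) ∞ M]

/-- Smooth Riemannian metrics on `M`. -/
abbrev Metric3 (M : Type*) [TopologicalSpace M] [ChartedSpace R3 M]
    [IsManifold 𝓘(ℝ, R3) ∞ M] : Type _ :=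
  Bundle.ContMDiffRiemannianMetric 𝓘(ℝ, R3) ∞ R3
    (fun x : M => TangentSpace 𝓘(ℝ, R3) x)

/-- `g` is compatible with `(ker ω, T)`: `ω(Y) = g(T, Y)` for all `Y`. -/
def Metric3.IsCompatible (g : Metric3 M) (ω : DForm R3 M 1) (T : VField R3 M) : Prop :=
  ∀ (x : M) (v : TangentSpace 𝓘(ℝ, R3) x), ω x ![v] = g.inner x (T x) v

/-- `e` is a `g`-orthonormal basis of the tangent space at `x`. -/
def Metric3.IsOrthonormal (g : Metric3 M) (x : M) (e : Fin 3 → TangentSpace 𝓘(ℝ, R3) x) : Prop :=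
  ∀ i j, g.inner x (e i) (e j) = if i = j then 1 else 0

/-- Two `k`-covectors at `x` are `g`-orthogonal: in orthonormal bases `e`, the sum of
`α (e_{i₁}, …, e_{i_k}) β (e_{i₁}, …, e_{i_k})` is zero. -/
def Metric3.CovOrthogonal (g : Metric3 M) {k : ℕ} (x : M)
    (α β : TangentSpace 𝓘(ℝ, R3) x [⋀^Fin k]→L[ℝ] ℝ) : Prop :=
  ∀ e : Fin 3 → TangentSpace 𝓘(ℝ, R3) x, g.IsOrthonormal x e →
    ∑ i : Fin k → Fin 3, α (fun a => e (i a)) * β (fun a => e (i a)) = 0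

/-- `η ∈ ω^⊥`, and `ω ∧ η` is the `g`-orthogonal projection of `dω` onto `ω ∧ ω^⊥`. -/
def Metric3.IsProjectionForm (g : Metric3 M) (ω η : DForm R3 M 1) : Prop :=
  ∀ x : M, g.CovOrthogonal x (η x) (ω x) ∧
    ∀ θ : TangentSpace 𝓘(ℝ, R3) x [⋀^Fin 1]→L[ℝ] ℝ, g.CovOrthogonal x θ (ω x) →
      g.CovOrthogonal x (ω.d x - altWedge (ω x) (η x)) (altWedge (ω x) θ)

end Metric

end

/-! ### Wedge products in low degree, on a single vector space. -/

section Algebra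

variable {V W : Type*} [AddCommGroup V] [Module ℝ V] [TopologicalSpace V]
  [AddCommGroup W] [Module ℝ W] [TopologicalSpace W] {k l : ℕ}

/-! The metric statement is linear algebra in one tangent space. In an orthonormal frame `T = ∑
ω(e_i) e_i`, so pairing a covector with `ω` evaluates it on `T`. For `ζ`, `θ` vanishing on `T`, the
pairing of `A - ω ∧ ζ` with `ω ∧ θ` is `2⟨ι_T A - ζ, θ⟩`; testing with `θ = ι_T A - ζ` forces `ζ =
ι_T A` (`projection_iff_eq_altInterior`).

The transformation rules are graded algebra. In (ii) and (iii), `η` changes by a one-form `β`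
because contraction and `d` are linear. The cross terms of `(η + β) ∧ d(η + β)` are `η ∧ dβ + β ∧
dη`, and `β ∧ dη = dη ∧ β` with `d(η ∧ β) = dη ∧ β - η ∧ dβ` turns them into `2 dη ∧ β - d(η ∧ β)`
(`wedge_d_add`). In (i), Leibniz and `ω(T) = 1` give the new `η` (`gvForm_rescale`); the formula for
`η ∧ dη` then uses `d(df) = 0` and `ω ∧ ω = 0` (`wedge_d_sub_funDiff_add`).

The analytic point is that `DForm.d` is computed in a different chart at every point.
`DForm.IsSmooth.inChart_d`, resting on the naturality of `extDeriv` under pull-back, shows that any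
fixed chart gives the same result; smoothness of `d` and `d ∘ d = 0` follow. The Leibniz rules need
only the chart at one point. -/

theorem altWedge_apply (α : V [⋀^Fin k]→L[ℝ] ℝ) (β : V [⋀^Fin l]→L[ℝ] ℝ) (v : Fin (k + l) → V) :
    altWedge α β v = ((k ! : ℝ) * (l ! : ℝ))⁻¹ * ∑ σ : Equiv.Perm (Fin (k + l)),
      ((Equiv.Perm.sign σ : ℤ) : ℝ) *
        (α (fun i => v (σ (Fin.castAdd l i))) * β (fun j => v (σ (Fin.natAdd k j)))) := by
  simp only [altWedge, ContinuousAlternatingMap.smul_apply, smul_eq_mul,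
    ContinuousMultilinearMap.alternatization_apply_apply]
  congr 1
  refine Finset.sum_congr rfl fun σ _ => ?_
  rw [Units.smul_def, zsmul_eq_mul]
  rfl

theorem altWedge_compContinuousLinearMap (α : W [⋀^Fin k]→L[ℝ] ℝ) (β : W [⋀^Fin l]→L[ℝ] ℝ)
    (f : V →L[ℝ] W) :
    (altWedge α β).compContinuousLinearMap f =
      altWedge (α.compContinuousLinearMap f) (β.compContinuousLinearMap f) := by
  ext v
  rw [ContinuousAlternatingMap.compContinuousLinearMap_apply, altWedge_apply, altWedge_apply]
  rfl

/-- A continuous alternating map of two arguments is antisymmetric. -/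
theorem alt_two_swap (α : V [⋀^Fin 2]→L[ℝ] ℝ) (u v : V) : α ![v, u] = -α ![u, v] := by
  have h : α.toAlternatingMap (![u, v] ∘ Equiv.swap 0 1) = -α.toAlternatingMap ![u, v] :=
    α.toAlternatingMap.map_swap ![u, v] (i := 0) (j := 1) (by decide)
  have e : ![u, v] ∘ Equiv.swap (0 : Fin 2) 1 = ![v, u] := by
    ext i; fin_cases i <;> rfl
  rwa [e] at h

theorem alt_two_self (α : V [⋀^Fin 2]→L[ℝ] ℝ) (u : V) : α ![u, u] = 0 :=
  α.map_eq_zero_of_eq _ (i := 0) (j := 1) rfl (by decide)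

theorem sum_perm_fin_two (F : Equiv.Perm (Fin 2) → ℝ) :
    ∑ σ, F σ = F 1 + F (Equiv.swap 0 1) := by
  have h : (Finset.univ : Finset (Equiv.Perm (Fin 2))) = {1, Equiv.swap 0 1} := by decide
  rw [h, Finset.sum_pair (by decide)]

theorem sum_perm_fin_three (F : Equiv.Perm (Fin 3) → ℝ) :
    ∑ σ, F σ = F 1 + F (Equiv.swap 0 1) + F (Equiv.swap 0 2) + F (Equiv.swap 1 2)
      + F (Equiv.swap 0 1 * Equiv.swap 1 2) + F (Equiv.swap 1 2 * Equiv.swap 0 1) := by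
  have h : (Finset.univ : Finset (Equiv.Perm (Fin 3))) = {1, Equiv.swap 0 1, Equiv.swap 0 2,
      Equiv.swap 1 2, Equiv.swap 0 1 * Equiv.swap 1 2, Equiv.swap 1 2 * Equiv.swap 0 1} := by
    decide
  rw [h, Finset.sum_insert (by decide), Finset.sum_insert (by decide),
    Finset.sum_insert (by decide), Finset.sum_insert (by decide), Finset.sum_pair (by decide)]
  ring

theorem eq_vec_one {X : Type*} (f : Fin 1 → X) : f = ![f 0] := by
  ext i; fin_cases i; rfl

theorem eq_vec_two {X : Type*} (f : Fin 2 → X) : f = ![f 0, f 1] := by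
  ext i; fin_cases i <;> rfl

theorem eq_vec_three {X : Type*} (f : Fin 3 → X) : f = ![f 0, f 1, f 2] := by
  ext i; fin_cases i <;> rfl

theorem altWedge_one_one (α β : V [⋀^Fin 1]→L[ℝ] ℝ) (u v : V) :
    altWedge α β ![u, v] = α ![u] * β ![v] - α ![v] * β ![u] := by
  rw [altWedge_apply]
  simp only [eq_vec_one (fun _ : Fin 1 => ![u, v] _)]
  refine (congrArg _ (sum_perm_fin_two _)).trans ?_
  rw [Equiv.Perm.sign_swap (by decide), Equiv.Perm.sign_one]
  change (((1 ! : ℕ) : ℝ) * ((1 ! : ℕ) : ℝ))⁻¹ *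
    (((1 : ℤ) : ℝ) * (α ![u] * β ![v]) + ((-1 : ℤ) : ℝ) * (α ![v] * β ![u])) = _
  norm_num
  ring

theorem altWedge_one_two (α : V [⋀^Fin 1]→L[ℝ] ℝ) (β : V [⋀^Fin 2]→L[ℝ] ℝ) (u v w : V) :
    altWedge α β ![u, v, w] =
      α ![u] * β ![v, w] - α ![v] * β ![u, w] + α ![w] * β ![u, v] := by
  rw [altWedge_apply]
  simp only [eq_vec_one (fun _ : Fin 1 => ![u, v, w] _), eq_vec_two (fun _ : Fin 2 => ![u, v, w] _)]
  refine (congrArg _ (sum_perm_fin_three _)).trans ?_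
  simp only [Equiv.Perm.sign_mul]
  rw [Equiv.Perm.sign_swap (by decide), Equiv.Perm.sign_swap (by decide),
    Equiv.Perm.sign_swap (by decide), Equiv.Perm.sign_one]
  change (((1 ! : ℕ) : ℝ) * ((2 ! : ℕ) : ℝ))⁻¹ *
    (((1 : ℤ) : ℝ) * (α ![u] * β ![v, w]) + ((-1 : ℤ) : ℝ) * (α ![v] * β ![u, w])
      + ((-1 : ℤ) : ℝ) * (α ![w] * β ![v, u]) + ((-1 : ℤ) : ℝ) * (α ![u] * β ![w, v])
      + ((1 : ℤ) : ℝ) * (α ![v] * β ![w, u]) + ((1 : ℤ) : ℝ) * (α ![w] * β ![u, v])) = _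
  -- The six terms pair up under exchanging the two arguments of `β`, which cancels the factor `1 /
  -- 2!`.
  rw [alt_two_swap β u v, alt_two_swap β v w, alt_two_swap β u w]
  norm_num
  ring

theorem altWedge_two_one (α : V [⋀^Fin 2]→L[ℝ] ℝ) (β : V [⋀^Fin 1]→L[ℝ] ℝ) (u v w : V) :
    altWedge α β ![u, v, w] =
      α ![u, v] * β ![w] - α ![u, w] * β ![v] + α ![v, w] * β ![u] := by
  rw [altWedge_apply]
  simp only [eq_vec_one (fun _ : Fin 1 => ![u, v, w] _), eq_vec_two (fun _ : Fin 2 => ![u, v, w] _)]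
  refine (congrArg _ (sum_perm_fin_three _)).trans ?_
  simp only [Equiv.Perm.sign_mul]
  rw [Equiv.Perm.sign_swap (by decide), Equiv.Perm.sign_swap (by decide),
    Equiv.Perm.sign_swap (by decide), Equiv.Perm.sign_one]
  change (((2 ! : ℕ) : ℝ) * ((1 ! : ℕ) : ℝ))⁻¹ *
    (((1 : ℤ) : ℝ) * (α ![u, v] * β ![w]) + ((-1 : ℤ) : ℝ) * (α ![v, u] * β ![w])
      + ((-1 : ℤ) : ℝ) * (α ![w, v] * β ![u]) + ((-1 : ℤ) : ℝ) * (α ![u, w] * β ![v])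
      + ((1 : ℤ) : ℝ) * (α ![v, w] * β ![u]) + ((1 : ℤ) : ℝ) * (α ![w, u] * β ![v])) = _
  rw [alt_two_swap α u v, alt_two_swap α v w, alt_two_swap α u w]
  norm_num
  ring

end Algebra

/-! ### Smoothness and exterior derivatives of forms on the model space. -/

section Calculus

variable {E : Type*} [NormedAddCommGroup E] [NormedSpace ℝ E] {k : ℕ}

/-- Evaluation on tuples of basis vectors is an injective linear map to a finite-dimensional space.
Composing with a linear left inverse, automatically continuous, recovers the form from finitely many
smooth coefficients. -/
theorem contDiffOn_alternating_iff [FiniteDimensional ℝ E] {F : E → E [⋀^Fin k]→L[ℝ] ℝ}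
    {s : Set E} {n : WithTop ℕ∞} :
    ContDiffOn ℝ n F s ↔ ∀ v : Fin k → E, ContDiffOn ℝ n (fun y => F y v) s := by
  refine ⟨fun h v => (ContinuousAlternatingMap.apply ℝ E ℝ v).contDiff.comp_contDiffOn h,
    fun h => ?_⟩
  let b := Module.finBasis ℝ E
  let L : (E [⋀^Fin k]→L[ℝ] ℝ) →ₗ[ℝ] ((Fin k → Fin (Module.finrank ℝ E)) → ℝ) :=
    { toFun := fun α i => α fun a => b (i a)
      map_add' := fun _ _ => rfl
      map_smul' := fun _ _ => rfl }
  have hL : Function.Injective L := fun α β hαβ => by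
    apply ContinuousAlternatingMap.toAlternatingMap_injective
    apply AlternatingMap.coe_multilinearMap_injective
    exact Module.Basis.ext_multilinear (fun _ => b) fun i => congrFun hαβ i
  obtain ⟨g, hg⟩ := L.exists_leftInverse_of_injective (LinearMap.ker_eq_bot.2 hL)
  have hF : F = fun y => g.toContinuousLinearMap (L (F y)) :=
    funext fun y => (LinearMap.congr_fun hg (F y)).symm
  rw [hF]
  exact g.toContinuousLinearMap.contDiff.comp_contDiffOn
    (contDiffOn_pi.2 fun i => h fun a => b (i a))

theorem ContDiffOn.altInterior {F : E → E [⋀^Fin (k + 1)]→L[ℝ] ℝ} {X : E → E} {s : Set E}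
    {n : WithTop ℕ∞} (hF : ContDiffOn ℝ n F s) (hX : ContDiffOn ℝ n X s) :
    ContDiffOn ℝ n (fun y => altInterior (X y) (F y)) s :=
  have h := ((ContinuousAlternatingMap.curryLeftLI (𝕜 := ℝ) (E := E) (F := ℝ)
    (n := k)).toContinuousLinearMap.contDiff.comp_contDiffOn hF).clm_apply hX
  h.congr fun _ _ => rfl

theorem ContDiffOn.altWedge_one_one [FiniteDimensional ℝ E] {F G : E → E [⋀^Fin 1]→L[ℝ] ℝ}
    {s : Set E} {n : WithTop ℕ∞} (hF : ContDiffOn ℝ n F s) (hG : ContDiffOn ℝ n G s) :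
    ContDiffOn ℝ n (fun y => (altWedge (F y) (G y) : E [⋀^Fin 2]→L[ℝ] ℝ)) s := by
  rw [contDiffOn_alternating_iff] at *
  intro v
  rw [eq_vec_two v]
  simp only [_root_.altWedge_one_one]
  exact ((hF _).mul (hG _)).sub ((hF _).mul (hG _))

theorem ContDiffOn.extDeriv {F : E → E [⋀^Fin k]→L[ℝ] ℝ} {s : Set E} (hs : IsOpen s)
    (hF : ContDiffOn ℝ ∞ F s) : ContDiffOn ℝ ∞ (extDeriv F) s :=
  (ContinuousAlternatingMap.alternatizeUncurryFinCLM ℝ E ℝ).contDiff.comp_contDiffOn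
    (hF.fderiv_of_isOpen hs (by simp))

/-- The arguments are constant vector fields on `E`, so no bracket term appears. -/
theorem extDeriv_one {F : E → E [⋀^Fin 1]→L[ℝ] ℝ} {y : E} (hF : DifferentiableAt ℝ F y)
    (u v : E) : extDeriv F y ![u, v] =
      fderiv ℝ (fun z => F z ![v]) y u - fderiv ℝ (fun z => F z ![u]) y v := by
  rw [extDeriv_apply hF]
  have h0 : (0 : Fin 2).removeNth ![u, v] = ![v] := by ext i; fin_cases i; rfl
  have h1 : (1 : Fin 2).removeNth ![u, v] = ![u] := by ext i; fin_cases i; rfl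
  simp [Fin.sum_univ_two, h0, h1, sub_eq_add_neg]

theorem extDeriv_two {F : E → E [⋀^Fin 2]→L[ℝ] ℝ} {y : E} (hF : DifferentiableAt ℝ F y)
    (u v w : E) : extDeriv F y ![u, v, w] =
      fderiv ℝ (fun z => F z ![v, w]) y u - fderiv ℝ (fun z => F z ![u, w]) y v
        + fderiv ℝ (fun z => F z ![u, v]) y w := by
  rw [extDeriv_apply hF]
  have h0 : (0 : Fin 3).removeNth ![u, v, w] = ![v, w] := by ext i; fin_cases i <;> rfl
  have h1 : (1 : Fin 3).removeNth ![u, v, w] = ![u, w] := by ext i; fin_cases i <;> rfl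
  have h2 : (2 : Fin 3).removeNth ![u, v, w] = ![u, v] := by ext i; fin_cases i <;> rfl
  simp [Fin.sum_univ_three, h0, h1, h2, sub_eq_add_neg]

end Calculus

/-! ### Forms and vector fields in charts; independence of `d` from the chart. -/

section Charts

variable {E : Type*} [NormedAddCommGroup E] [NormedSpace ℝ E]
variable {M : Type*} [TopologicalSpace M] [ChartedSpace E M] {k : ℕ}

/-- A function is smooth if its expressions in the charts are smooth. -/
def SmoothInCharts (E : Type*) [NormedAddCommGroup E] [NormedSpace ℝ E] {M : Type*}
    [TopologicalSpace M] [ChartedSpace E M] (f : M → ℝ) : Prop :=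
  ∀ x₀ : M, ContDiffOn ℝ ∞ (fun y => f ((chartAt E x₀).symm y)) (chartAt E x₀).target

/-- The expression of a vector field in the chart at `x₀`. -/
noncomputable def VField.inChart (X : VField E M) (x₀ : M) : E → E := fun y =>
  (mfderiv 𝓘(ℝ, E) 𝓘(ℝ, E) (chartAt E x₀) ((chartAt E x₀).symm y) :
    TangentSpace 𝓘(ℝ, E) ((chartAt E x₀).symm y) →L[ℝ] E) (X ((chartAt E x₀).symm y))

/-- The coefficients of a form, as a map to the fixed space of alternating forms on `E`. -/
def DForm.coeff (ω : DForm E M k) (x : M) : E [⋀^Fin k]→L[ℝ] ℝ := ω x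

theorem DForm.IsSmooth.contDiffAt {ω : DForm E M k} (hω : ω.IsSmooth) {x₀ : M} {y : E}
    (hy : y ∈ (chartAt E x₀).target) : ContDiffAt ℝ ∞ (ω.inChart x₀) y :=
  (hω x₀).contDiffAt ((chartAt E x₀).open_target.mem_nhds hy)

theorem DForm.IsSmooth.differentiableAt {ω : DForm E M k} (hω : ω.IsSmooth) (x : M) :
    DifferentiableAt ℝ (ω.inChart x) (chartAt E x x) :=
  (hω.contDiffAt (mem_chart_target E x)).differentiableAt (by simp)

theorem DForm.IsSmooth.add {α β : DForm E M k} (hα : α.IsSmooth) (hβ : β.IsSmooth) :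
    (α + β).IsSmooth := fun x₀ => (hα x₀).add (hβ x₀)

theorem DForm.IsSmooth.neg {α : DForm E M k} (hα : α.IsSmooth) : (-α).IsSmooth :=
  fun x₀ => (hα x₀).neg

theorem DForm.IsSmooth.sub {α β : DForm E M k} (hα : α.IsSmooth) (hβ : β.IsSmooth) :
    (α - β).IsSmooth := fun x₀ => (hα x₀).sub (hβ x₀)

theorem DForm.IsSmooth.mulFun {f : M → ℝ} {α : DForm E M k} (hf : SmoothInCharts E f)
    (hα : α.IsSmooth) : (DForm.mulFun f α).IsSmooth := fun x₀ => (hf x₀).smul (hα x₀)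

theorem DForm.inChart_wedge {l : ℕ} (α : DForm E M k) (β : DForm E M l) (x₀ : M) (y : E) :
    (α.wedge β).inChart x₀ y = altWedge (α.inChart x₀ y) (β.inChart x₀ y) :=
  altWedge_compContinuousLinearMap _ _ _

theorem DForm.IsSmooth.wedge_one_one [FiniteDimensional ℝ E] {α β : DForm E M 1}
    (hα : α.IsSmooth) (hβ : β.IsSmooth) : (α.wedge β).IsSmooth := fun x₀ =>
  ((hα x₀).altWedge_one_one (hβ x₀)).congr fun _ _ => DForm.inChart_wedge α β _ _

variable [IsManifold 𝓘(ℝ, E) ∞ M]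

/-- The regularity under which `extDeriv` squares to zero and commutes with pull-back. -/
theorem minSmoothness_real_two_le : minSmoothness ℝ 2 ≤ ∞ := by
  rw [minSmoothness_of_isRCLikeNormedField]
  exact WithTop.coe_le_coe.2 le_top

theorem ContMDiff.smoothInCharts {f : M → ℝ} (hf : ContMDiff 𝓘(ℝ, E) 𝓘(ℝ, ℝ) ∞ f) :
    SmoothInCharts E f := fun x₀ =>
  (hf.comp_contMDiffOn (contMDiffOn_chart_symm (x := x₀))).contDiffOn

theorem contDiffAt_chart_comp_symm {x₀ x : M} {y : E} (hy : y ∈ (chartAt E x₀).target)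
    (hx : (chartAt E x₀).symm y ∈ (chartAt E x).source) :
    ContDiffAt ℝ ∞ (fun z => chartAt E x ((chartAt E x₀).symm z)) y := by
  have h1 : ContMDiffAt 𝓘(ℝ, E) 𝓘(ℝ, E) ∞ (chartAt E x₀).symm y :=
    contMDiffOn_chart_symm.contMDiffAt ((chartAt E x₀).open_target.mem_nhds hy)
  have h2 : ContMDiffAt 𝓘(ℝ, E) 𝓘(ℝ, E) ∞ (chartAt E x) ((chartAt E x₀).symm y) :=
    contMDiffOn_chart.contMDiffAt ((chartAt E x).open_source.mem_nhds hx)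
  exact (h2.comp y h1).contDiffAt

theorem mdifferentiableAt_chart_symm {x₀ : M} {y : E} (hy : y ∈ (chartAt E x₀).target) :
    MDifferentiableAt 𝓘(ℝ, E) 𝓘(ℝ, E) (chartAt E x₀).symm y :=
  (contMDiffOn_chart_symm (n := ∞).contMDiffAt
    ((chartAt E x₀).open_target.mem_nhds hy)).mdifferentiableAt (by simp)

theorem mdifferentiableAt_chart {x₀ x : M} (hx : x ∈ (chartAt E x₀).source) :
    MDifferentiableAt 𝓘(ℝ, E) 𝓘(ℝ, E) (chartAt E x₀) x :=
  (contMDiffOn_chart (n := ∞).contMDiffAt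
    ((chartAt E x₀).open_source.mem_nhds hx)).mdifferentiableAt (by simp)

/-- The tangent space at a point is `E` itself, read through the preferred chart there; the
derivative of a chart is therefore that of a transition map. -/
theorem mfderiv_chart_symm {x₀ : M} {y : E} (hy : y ∈ (chartAt E x₀).target) :
    (mfderiv 𝓘(ℝ, E) 𝓘(ℝ, E) (chartAt E x₀).symm y : E →L[ℝ] E) =
      fderiv ℝ (fun z => chartAt E ((chartAt E x₀).symm y) ((chartAt E x₀).symm z)) y := by
  refine (mdifferentiableAt_chart_symm hy).mfderiv.trans ?_
  simp [writtenInExtChartAt, Function.comp_def]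
  rfl

theorem mfderiv_chart {x₀ x : M} (hx : x ∈ (chartAt E x₀).source) :
    (mfderiv 𝓘(ℝ, E) 𝓘(ℝ, E) (chartAt E x₀) x : E →L[ℝ] E) =
      fderiv ℝ (fun z => chartAt E x₀ ((chartAt E x).symm z)) (chartAt E x x) := by
  refine (mdifferentiableAt_chart hx).mfderiv.trans ?_
  simp [writtenInExtChartAt, Function.comp_def]
  rfl

theorem mfderiv_chart_self (x : M) :
    (mfderiv 𝓘(ℝ, E) 𝓘(ℝ, E) (chartAt E x) x : E →L[ℝ] E) = ContinuousLinearMap.id ℝ E := by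
  rw [mfderiv_chart (mem_chart_source E x)]
  have : (fun z => chartAt E x ((chartAt E x).symm z)) =ᶠ[nhds (chartAt E x x)] id := by
    filter_upwards [(chartAt E x).open_target.mem_nhds (mem_chart_target E x)] with z hz
    exact (chartAt E x).right_inv hz
  rw [this.fderiv_eq, fderiv_id]

theorem mfderiv_chart_symm_self (x : M) :
    (mfderiv 𝓘(ℝ, E) 𝓘(ℝ, E) (chartAt E x).symm (chartAt E x x) : E →L[ℝ] E) =
      ContinuousLinearMap.id ℝ E := by
  rw [mfderiv_chart_symm (mem_chart_target E x), (chartAt E x).left_inv (mem_chart_source E x)]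
  have : (fun z => chartAt E x ((chartAt E x).symm z)) =ᶠ[nhds (chartAt E x x)] id := by
    filter_upwards [(chartAt E x).open_target.mem_nhds (mem_chart_target E x)] with z hz
    exact (chartAt E x).right_inv hz
  rw [this.fderiv_eq, fderiv_id]

theorem DForm.inChart_eq (ω : DForm E M k) {x₀ : M} {y : E} (hy : y ∈ (chartAt E x₀).target) :
    ω.inChart x₀ y = (ω.coeff ((chartAt E x₀).symm y)).compContinuousLinearMap
      (fderiv ℝ (fun z => chartAt E ((chartAt E x₀).symm y) ((chartAt E x₀).symm z)) y) := by
  rw [← mfderiv_chart_symm hy]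
  rfl

theorem DForm.inChart_self (ω : DForm E M k) (x : M) :
    ω.inChart x (chartAt E x x) = ω.coeff x := by
  have h : ω.inChart x (chartAt E x x) =
    (ω.coeff ((chartAt E x).symm (chartAt E x x))).compContinuousLinearMap
      (mfderiv 𝓘(ℝ, E) 𝓘(ℝ, E) (chartAt E x).symm (chartAt E x x) : E →L[ℝ] E) := rfl
  rw [h, mfderiv_chart_symm_self, (chartAt E x).left_inv (mem_chart_source E x)]
  rfl

theorem DForm.coeff_d (ω : DForm E M k) (x : M) :
    ω.d.coeff x = extDeriv (ω.inChart x) (chartAt E x x) := by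
  have h : ω.d.coeff x = (extDeriv (ω.inChart x) (chartAt E x x)).compContinuousLinearMap
    (mfderiv 𝓘(ℝ, E) 𝓘(ℝ, E) (chartAt E x) x : E →L[ℝ] E) := rfl
  rw [h, mfderiv_chart_self]
  rfl

/-- Change of charts: the expressions of a form in two charts are related by pull-back. -/
theorem DForm.inChart_change (ω : DForm E M k) {x₀ x : M} {y : E}
    (hy : y ∈ (chartAt E x₀).target) (hx : (chartAt E x₀).symm y ∈ (chartAt E x).source) :
    ω.inChart x₀ y = (ω.inChart x (chartAt E x ((chartAt E x₀).symm y))).compContinuousLinearMap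
      (fderiv ℝ (fun z => chartAt E x ((chartAt E x₀).symm z)) y) := by
  set p := (chartAt E x₀).symm y with hp
  have hxp : (chartAt E x).symm (chartAt E x p) = p := (chartAt E x).left_inv hx
  rw [ω.inChart_eq hy, ω.inChart_eq ((chartAt E x).map_source hx), hxp, ← hp]
  -- Near `y`, the transition to the preferred chart at `p` factors through the chart at `x`, so the
  -- chain rule applies.
  have hev : (fun z => chartAt E p ((chartAt E x₀).symm z)) =ᶠ[nhds y]
      (fun w => chartAt E p ((chartAt E x).symm w)) ∘
        (fun z => chartAt E x ((chartAt E x₀).symm z)) := by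
    have hc : ContinuousAt (chartAt E x₀).symm y := (chartAt E x₀).continuousAt_symm hy
    filter_upwards [hc.preimage_mem_nhds ((chartAt E x).open_source.mem_nhds hx)] with z hz
    simp only [Function.comp_apply]
    rw [(chartAt E x).left_inv hz]
  have h1 : DifferentiableAt ℝ (fun w => chartAt E p ((chartAt E x).symm w))
      (chartAt E x ((chartAt E x₀).symm y)) :=
    (contDiffAt_chart_comp_symm ((chartAt E x).map_source hx)
      (by rw [hxp]; exact mem_chart_source E p)).differentiableAt (by simp)
  have h2 : DifferentiableAt ℝ (fun z => chartAt E x ((chartAt E x₀).symm z)) y :=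
    (contDiffAt_chart_comp_symm hy hx).differentiableAt (by simp)
  rw [hev.fderiv_eq, fderiv_comp y h1 h2]
  rfl

/-- The exterior derivative may be computed in any chart. -/
theorem DForm.IsSmooth.inChart_d {ω : DForm E M k} (hω : ω.IsSmooth) {x₀ : M} {y : E}
    (hy : y ∈ (chartAt E x₀).target) : ω.d.inChart x₀ y = extDeriv (ω.inChart x₀) y := by
  rw [ω.d.inChart_eq hy, ω.coeff_d]
  set p := (chartAt E x₀).symm y with hp
  have hps : (chartAt E x₀).symm y ∈ (chartAt E p).source := mem_chart_source E p
  -- Near `y` the form is the pull-back of its expression in the single chart at `p`, and that chart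
  -- is the one defining `d` at `p`.
  have hev : ω.inChart x₀ =ᶠ[nhds y] fun z =>
      (ω.inChart p (chartAt E p ((chartAt E x₀).symm z))).compContinuousLinearMap
        (fderiv ℝ (fun z => chartAt E p ((chartAt E x₀).symm z)) z) := by
    have hc : ContinuousAt (chartAt E x₀).symm y := (chartAt E x₀).continuousAt_symm hy
    filter_upwards [hc.preimage_mem_nhds ((chartAt E p).open_source.mem_nhds hps),
      (chartAt E x₀).open_target.mem_nhds hy] with z hz hz'
    exact ω.inChart_change hz' hz
  rw [hev.extDeriv_eq]
  exact (extDeriv_pullback (f := fun z => chartAt E p ((chartAt E x₀).symm z))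
    (hω.differentiableAt p) (contDiffAt_chart_comp_symm hy hps) minSmoothness_real_two_le).symm

theorem DForm.IsSmooth.d {ω : DForm E M k} (hω : ω.IsSmooth) : ω.d.IsSmooth := fun x₀ =>
  ((hω x₀).extDeriv (chartAt E x₀).open_target).congr fun _ hy => hω.inChart_d hy

theorem DForm.IsSmooth.d_d {ω : DForm E M k} (hω : ω.IsSmooth) : ω.d.d = 0 := by
  funext x
  have hev : ω.d.inChart x =ᶠ[nhds (chartAt E x x)] extDeriv (ω.inChart x) := by
    filter_upwards [(chartAt E x).open_target.mem_nhds (mem_chart_target E x)] with z hz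
    exact hω.inChart_d hz
  have h : ω.d.d.coeff x = 0 := by
    rw [DForm.coeff_d, hev.extDeriv_eq]
    exact extDeriv_extDeriv_apply (hω.contDiffAt (mem_chart_target E x)) minSmoothness_real_two_le
  exact h

/-- The two transition maps are mutually inverse near the point, so the chain rule makes their
derivatives inverse. -/
theorem mfderiv_chart_symm_chart {x₀ : M} {y : E} (hy : y ∈ (chartAt E x₀).target) (v : E) :
    (mfderiv 𝓘(ℝ, E) 𝓘(ℝ, E) (chartAt E x₀).symm y : E →L[ℝ] E)
      ((mfderiv 𝓘(ℝ, E) 𝓘(ℝ, E) (chartAt E x₀) ((chartAt E x₀).symm y) : E →L[ℝ] E) v) = v := by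
  have hp0 := (chartAt E x₀).map_target hy
  rw [mfderiv_chart_symm hy, mfderiv_chart hp0]
  have hr := (chartAt E x₀).right_inv hy
  set p := (chartAt E x₀).symm y with hp
  have hl := (chartAt E p).left_inv (mem_chart_source E p)
  have h2 : DifferentiableAt ℝ (fun z => chartAt E x₀ ((chartAt E p).symm z)) (chartAt E p p) :=
    (contDiffAt_chart_comp_symm (mem_chart_target E p) (by rwa [hl])).differentiableAt (by simp)
  have h1 : DifferentiableAt ℝ (fun z => chartAt E p ((chartAt E x₀).symm z))
      (chartAt E x₀ ((chartAt E p).symm (chartAt E p p))) := by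
    rw [hl, hr]
    exact (contDiffAt_chart_comp_symm hy (mem_chart_source E p)).differentiableAt (by simp)
  have hev : (fun z => chartAt E p ((chartAt E x₀).symm z)) ∘
      (fun z => chartAt E x₀ ((chartAt E p).symm z)) =ᶠ[nhds (chartAt E p p)] id := by
    have hc : ContinuousAt (chartAt E p).symm (chartAt E p p) :=
      (chartAt E p).continuousAt_symm (mem_chart_target E p)
    filter_upwards [(chartAt E p).open_target.mem_nhds (mem_chart_target E p),
      hc.preimage_mem_nhds ((chartAt E x₀).open_source.mem_nhds (by rwa [hl]))] with z hz hz'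
    simp only [Function.comp_apply]
    rw [(chartAt E x₀).left_inv hz', (chartAt E p).right_inv hz]
    rfl
  have h := fderiv_comp (chartAt E p p) h1 h2
  rw [hev.fderiv_eq, fderiv_id, hl, hr] at h
  exact (congrArg (fun L : E →L[ℝ] E => L v) h).symm

theorem DForm.inChart_interior (X : VField E M) (α : DForm E M (k + 1)) {x₀ : M} {y : E}
    (hy : y ∈ (chartAt E x₀).target) :
    (α.interior X).inChart x₀ y = altInterior (X.inChart x₀ y) (α.inChart x₀ y) := by
  ext v
  have h := mfderiv_chart_symm_chart hy (X ((chartAt E x₀).symm y))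
  let L : E →L[ℝ] E := mfderiv 𝓘(ℝ, E) 𝓘(ℝ, E) (chartAt E x₀).symm y
  change α.coeff _ (Matrix.vecCons (X ((chartAt E x₀).symm y)) (L ∘ v)) =
    α.coeff _ (L ∘ Matrix.vecCons (X.inChart x₀ y) v)
  congr 1
  ext i
  refine Fin.cases ?_ (fun i => rfl) i
  exact h.symm

theorem VField.IsSmooth.contDiffOn {X : VField E M} (hX : X.IsSmooth) (x₀ : M) :
    ContDiffOn ℝ ∞ (X.inChart x₀) (chartAt E x₀).target := by
  have h := ((trivializationAt E (TangentSpace 𝓘(ℝ, E)) x₀).contMDiffOn_section_baseSet_iff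
    (IB := 𝓘(ℝ, E)) (n := ∞)).1 hX.contMDiffOn
  have h2 := h.comp (contMDiffOn_chart_symm (I := 𝓘(ℝ, E)) (n := ∞) (x := x₀))
    (fun y hy => (chartAt E x₀).map_target hy)
  refine h2.contDiffOn.congr fun y hy => ?_
  have hp := (chartAt E x₀).map_target hy
  -- The trivialization at `x₀` acts on fibres by the derivative of the chart, so the bundle
  -- coordinate of `X` is `X.inChart x₀`.
  have h3 := TangentBundle.continuousLinearMapAt_trivializationAt (I := 𝓘(ℝ, E)) hp
  have h4 := congrArg (fun L => L (X ((chartAt E x₀).symm y))) h3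
  simp only [Bundle.Trivialization.continuousLinearMapAt_apply] at h4
  rw [Bundle.Trivialization.linearMapAt_apply, if_pos (by exact hp)] at h4
  refine Eq.trans ?_ h4.symm
  simp [VField.inChart]
  rfl

theorem DForm.IsSmooth.interior {X : VField E M} {α : DForm E M (k + 1)} (hα : α.IsSmooth)
    (hX : X.IsSmooth) : (α.interior X).IsSmooth := fun x₀ =>
  ((hα x₀).altInterior (hX.contDiffOn x₀)).congr fun _ hy => DForm.inChart_interior X α hy

/-- The function is the zero-form `ι_X α` evaluated on the empty tuple. -/
theorem DForm.IsSmooth.pair {X : VField E M} {α : DForm E M 1} (hα : α.IsSmooth)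
    (hX : X.IsSmooth) : SmoothInCharts E (α.pair X) := fun x₀ => by
  refine ((ContinuousAlternatingMap.apply ℝ E ℝ ![]).contDiff.comp_contDiffOn
    (hα.interior hX x₀)).congr fun y _ => ?_
  change α.coeff _ _ = α.coeff _ _
  congr 1
  ext i
  fin_cases i
  rfl

theorem funDiff_inChart_apply {f : M → ℝ} (hf : ContMDiff 𝓘(ℝ, E) 𝓘(ℝ, ℝ) ∞ f) {x₀ : M} {y : E}
    (hy : y ∈ (chartAt E x₀).target) :
    DForm.inChart (funDiff f) x₀ y = ContinuousAlternatingMap.ofSubsingleton ℝ E ℝ (0 : Fin 1)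
      (fderiv ℝ (fun z => f ((chartAt E x₀).symm z)) y) := by
  have h := mfderiv_comp (I' := 𝓘(ℝ, E)) y (hf.mdifferentiableAt (by simp))
    (mdifferentiableAt_chart_symm hy)
  rw [mfderiv_eq_fderiv] at h
  ext v
  exact (congrArg (fun L : E →L[ℝ] ℝ => L (v 0)) h).symm

theorem funDiff_isSmooth {f : M → ℝ} (hf : ContMDiff 𝓘(ℝ, E) 𝓘(ℝ, ℝ) ∞ f) :
    (funDiff f : DForm E M 1).IsSmooth := fun x₀ =>
  ((ContinuousAlternatingMap.ofSubsingletonLIE (𝕜 := ℝ) (E := E) (F := ℝ)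
    (0 : Fin 1)).contDiff.comp_contDiffOn
    ((hf.smoothInCharts x₀).fderiv_of_isOpen (chartAt E x₀).open_target (by simp))).congr
    fun _ hy => funDiff_inChart_apply hf hy

end Charts

/-! ### Leibniz rules, linearity of `d`, and `d(df) = 0`. -/

section Leibniz

variable {E : Type*} [NormedAddCommGroup E] [NormedSpace ℝ E]

theorem DifferentiableAt.alternating_apply_const {k : ℕ} {F : E → E [⋀^Fin k]→L[ℝ] ℝ} {y : E}
    (hF : DifferentiableAt ℝ F y) (v : Fin k → E) : DifferentiableAt ℝ (fun z => F z v) y :=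
  (ContinuousAlternatingMap.apply ℝ E ℝ v).differentiableAt.comp y hF

theorem extDeriv_smul_one {f : E → ℝ} {F : E → E [⋀^Fin 1]→L[ℝ] ℝ} {y : E}
    (hf : DifferentiableAt ℝ f y) (hF : DifferentiableAt ℝ F y) (u v : E) :
    extDeriv (fun z => f z • F z) y ![u, v] =
      fderiv ℝ f y u * F y ![v] - fderiv ℝ f y v * F y ![u] + f y * extDeriv F y ![u, v] := by
  rw [extDeriv_one (hf.fun_smul hF), extDeriv_one hF]
  simp only [ContinuousAlternatingMap.smul_apply, smul_eq_mul]
  rw [fderiv_fun_mul hf (hF.alternating_apply_const _),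
    fderiv_fun_mul hf (hF.alternating_apply_const _)]
  simp only [add_apply, smul_apply, smul_eq_mul]
  ring

theorem extDeriv_smul_two {f : E → ℝ} {F : E → E [⋀^Fin 2]→L[ℝ] ℝ} {y : E}
    (hf : DifferentiableAt ℝ f y) (hF : DifferentiableAt ℝ F y) (u v w : E) :
    extDeriv (fun z => f z • F z) y ![u, v, w] =
      fderiv ℝ f y u * F y ![v, w] - fderiv ℝ f y v * F y ![u, w]
        + fderiv ℝ f y w * F y ![u, v] + f y * extDeriv F y ![u, v, w] := by
  rw [extDeriv_two (hf.fun_smul hF), extDeriv_two hF]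
  simp only [ContinuousAlternatingMap.smul_apply, smul_eq_mul]
  rw [fderiv_fun_mul hf (hF.alternating_apply_const _),
    fderiv_fun_mul hf (hF.alternating_apply_const _),
    fderiv_fun_mul hf (hF.alternating_apply_const _)]
  simp only [add_apply, smul_apply, smul_eq_mul]
  ring

theorem extDeriv_altWedge_one_one {F G : E → E [⋀^Fin 1]→L[ℝ] ℝ} {y : E}
    (hF : DifferentiableAt ℝ F y) (hG : DifferentiableAt ℝ G y)
    (hFG : DifferentiableAt ℝ (fun z => (altWedge (F z) (G z) : E [⋀^Fin 2]→L[ℝ] ℝ)) y)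
    (u v w : E) :
    extDeriv (fun z => (altWedge (F z) (G z) : E [⋀^Fin 2]→L[ℝ] ℝ)) y ![u, v, w] =
      altWedge (extDeriv F y) (G y) ![u, v, w] - altWedge (F y) (extDeriv G y) ![u, v, w] := by
  have hd (a b : E) : fderiv ℝ (fun z => F z ![a] * G z ![b] - F z ![b] * G z ![a]) y =
      F y ![a] • fderiv ℝ (fun z => G z ![b]) y + G y ![b] • fderiv ℝ (fun z => F z ![a]) y
      - (F y ![b] • fderiv ℝ (fun z => G z ![a]) y
        + G y ![a] • fderiv ℝ (fun z => F z ![b]) y) := by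
    have h1 (c : E) := hF.alternating_apply_const ![c]
    have h2 (c : E) := hG.alternating_apply_const ![c]
    rw [fderiv_fun_sub ((h1 a).fun_mul (h2 b)) ((h1 b).fun_mul (h2 a)),
      fderiv_fun_mul (h1 a) (h2 b), fderiv_fun_mul (h1 b) (h2 a)]
  rw [extDeriv_two hFG]
  simp only [altWedge_one_one, hd]
  rw [altWedge_two_one, altWedge_one_two]
  simp only [extDeriv_one hF, extDeriv_one hG, add_apply, sub_apply, smul_apply, smul_eq_mul]
  ring

variable {M : Type*} [TopologicalSpace M] [ChartedSpace E M] {k : ℕ}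

theorem DForm.ext_two {α β : DForm E M 2}
    (h : ∀ x u v, α.coeff x ![u, v] = β.coeff x ![u, v]) : α = β := by
  funext x
  ext v
  rw [eq_vec_two v]
  exact h x _ _

theorem DForm.ext_three {α β : DForm E M 3}
    (h : ∀ x u v w, α.coeff x ![u, v, w] = β.coeff x ![u, v, w]) : α = β := by
  funext x
  ext v
  rw [eq_vec_three v]
  exact h x _ _ _

variable [IsManifold 𝓘(ℝ, E) ∞ M]

theorem SmoothInCharts.contMDiff {f : M → ℝ} (hf : SmoothInCharts E f) :
    ContMDiff 𝓘(ℝ, E) 𝓘(ℝ, ℝ) ∞ f := fun x => by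
  have h := (hf x).contMDiffOn.comp (contMDiffOn_chart (I := 𝓘(ℝ, E)) (n := ∞) (x := x))
    (fun p hp => (chartAt E x).map_source hp)
  have hs : (chartAt E x).source ∈ nhds x :=
    (chartAt E x).open_source.mem_nhds (mem_chart_source E x)
  refine (h.contMDiffAt hs).congr_of_eventuallyEq ?_
  filter_upwards [hs] with p hp
  simp only [Function.comp_apply]
  rw [(chartAt E x).left_inv hp]

theorem DForm.d_add {α β : DForm E M k} (hα : α.IsSmooth) (hβ : β.IsSmooth) :
    (α + β).d = α.d + β.d := by
  funext x
  have h : (α + β).d.coeff x = α.d.coeff x + β.d.coeff x := by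
    simp only [DForm.coeff_d]
    exact extDeriv_add (hα.differentiableAt x) (hβ.differentiableAt x)
  exact h

theorem DForm.d_neg (α : DForm E M k) : (-α).d = -α.d := by
  funext x
  have h : (-α).d.coeff x = -α.d.coeff x := by
    simp only [DForm.coeff_d]
    -- Constant scalars pass through `extDeriv` without differentiability, so `α` can be arbitrary.
    have := extDeriv_smul (x := chartAt E x x) (-1 : ℝ) (α.inChart x)
    rw [neg_one_smul, neg_one_smul] at this
    exact this
  exact h

theorem DForm.d_sub {α β : DForm E M k} (hα : α.IsSmooth) (hβ : β.IsSmooth) :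
    (α - β).d = α.d - β.d := by
  rw [sub_eq_add_neg, DForm.d_add hα hβ.neg, DForm.d_neg, sub_eq_add_neg]

theorem coeff_funDiff {f : M → ℝ} (hf : ContMDiff 𝓘(ℝ, E) 𝓘(ℝ, ℝ) ∞ f) (x : M) (v : E) :
    DForm.coeff (funDiff f) x ![v] =
      fderiv ℝ (fun z => f ((chartAt E x).symm z)) (chartAt E x x) v := by
  rw [← DForm.inChart_self, funDiff_inChart_apply hf (mem_chart_target E x)]
  rfl

theorem ContMDiff.differentiableAt_comp_chart_symm {f : M → ℝ}
    (hf : ContMDiff 𝓘(ℝ, E) 𝓘(ℝ, ℝ) ∞ f) (x : M) :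
    DifferentiableAt ℝ (fun z => f ((chartAt E x).symm z)) (chartAt E x x) :=
  ((hf.smoothInCharts x).contDiffAt
    ((chartAt E x).open_target.mem_nhds (mem_chart_target E x))).differentiableAt (by simp)

theorem DForm.d_mulFun_one {f : M → ℝ} {α : DForm E M 1}
    (hf : ContMDiff 𝓘(ℝ, E) 𝓘(ℝ, ℝ) ∞ f) (hα : α.IsSmooth) :
    (DForm.mulFun f α).d = (funDiff f).wedge α + DForm.mulFun f α.d := by
  refine DForm.ext_two fun x u v => ?_
  change _ = altWedge (DForm.coeff (funDiff f) x) (α.coeff x) ![u, v] + f x * α.d.coeff x ![u, v]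
  rw [altWedge_one_one]
  simp only [DForm.coeff_d, coeff_funDiff hf]
  have h := extDeriv_smul_one (hf.differentiableAt_comp_chart_symm x) (hα.differentiableAt x) u v
  rw [α.inChart_self, (chartAt E x).left_inv (mem_chart_source E x)] at h
  exact h

theorem DForm.d_mulFun_two {f : M → ℝ} {α : DForm E M 2}
    (hf : ContMDiff 𝓘(ℝ, E) 𝓘(ℝ, ℝ) ∞ f) (hα : α.IsSmooth) :
    (DForm.mulFun f α).d = (funDiff f).wedge α + DForm.mulFun f α.d := by
  refine DForm.ext_three fun x u v w => ?_
  change _ = altWedge (DForm.coeff (funDiff f) x) (α.coeff x) ![u, v, w]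
    + f x * α.d.coeff x ![u, v, w]
  rw [altWedge_one_two]
  simp only [DForm.coeff_d, coeff_funDiff hf]
  have h := extDeriv_smul_two (hf.differentiableAt_comp_chart_symm x) (hα.differentiableAt x) u v w
  rw [α.inChart_self, (chartAt E x).left_inv (mem_chart_source E x)] at h
  exact h

theorem DForm.d_wedge_one_one [FiniteDimensional ℝ E] {α β : DForm E M 1}
    (hα : α.IsSmooth) (hβ : β.IsSmooth) :
    (α.wedge β).d = α.d.wedge β - α.wedge β.d := by
  refine DForm.ext_three fun x u v w => ?_
  change (α.wedge β).d.coeff x ![u, v, w] = altWedge (α.d.coeff x) (β.coeff x) ![u, v, w]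
    - altWedge (α.coeff x) (β.d.coeff x) ![u, v, w]
  simp only [DForm.coeff_d]
  have he : (α.wedge β).inChart x = fun y => altWedge (α.inChart x y) (β.inChart x y) :=
    funext fun y => DForm.inChart_wedge α β x y
  have hd := (hα.wedge_one_one hβ).differentiableAt x
  rw [he] at hd ⊢
  have h := extDeriv_altWedge_one_one (hα.differentiableAt x) (hβ.differentiableAt x) hd u v w
  rw [α.inChart_self, β.inChart_self] at h
  exact h

/-- In a chart, `df` is the exterior derivative of `f` viewed as a zero-form, and `extDeriv` squares
to zero. -/
theorem d_funDiff {f : M → ℝ} (hf : ContMDiff 𝓘(ℝ, E) 𝓘(ℝ, ℝ) ∞ f) :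
    (funDiff f : DForm E M 1).d = 0 := by
  funext x
  have hev : DForm.inChart (funDiff f) x =ᶠ[nhds (chartAt E x x)]
      extDeriv fun z => ContinuousAlternatingMap.constOfIsEmpty ℝ E (Fin 0)
        (f ((chartAt E x).symm z)) := by
    filter_upwards [(chartAt E x).open_target.mem_nhds (mem_chart_target E x)] with z hz
    rw [funDiff_inChart_apply hf hz, extDeriv_constOfIsEmpty]
  have h : (DForm.d (funDiff f : DForm E M 1)).coeff x = 0 := by
    rw [DForm.coeff_d, hev.extDeriv_eq]
    refine extDeriv_extDeriv_apply (r := ∞) ?_ minSmoothness_real_two_le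
    exact (ContinuousAlternatingMap.constOfIsEmptyLIE ℝ E ℝ (Fin 0)).contDiff.contDiffAt.comp _
      ((hf.smoothInCharts x).contDiffAt
        ((chartAt E x).open_target.mem_nhds (mem_chart_target E x)))
  exact h

end Leibniz

/-! ### Orthonormal frames and the projection in one tangent space. -/

section Orthonormal

theorem sum_fin_one_family {X : Type*} (f : (Fin 1 → X) → ℝ) (e : Fin 3 → X) :
    ∑ i : Fin 1 → Fin 3, f (fun a => e (i a)) = f ![e 0] + f ![e 1] + f ![e 2] := by
  rw [← Fin.sum_univ_three (fun j => f ![e j])]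
  refine Fintype.sum_equiv (Equiv.funUnique (Fin 1) (Fin 3)) _ _ fun i => ?_
  rw [eq_vec_one (fun a => e (i a))]
  rfl

theorem sum_fin_two_family {X : Type*} (f : (Fin 2 → X) → ℝ) (e : Fin 3 → X) :
    ∑ i : Fin 2 → Fin 3, f (fun a => e (i a)) = ∑ i : Fin 3, ∑ j : Fin 3, f ![e i, e j] := by
  rw [← Fintype.sum_prod_type']
  refine Fintype.sum_equiv (finTwoArrowEquiv (Fin 3)) _ _ fun i => ?_
  rw [eq_vec_two (fun a => e (i a))]
  rfl

variable {V : Type*} [AddCommGroup V] [Module ℝ V]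

/-- Orthogonality of covectors quantifies over all orthonormal frames; the existence of one keeps
that condition from being vacuous. Positivity allows an orthogonal basis to be normalised. -/
theorem exists_orthonormal_three (hV : Module.finrank ℝ V = 3) (B : LinearMap.BilinForm ℝ V)
    (hs : ∀ v w, B v w = B w v) (hp : ∀ v, v ≠ 0 → 0 < B v v) :
    ∃ e : Fin 3 → V, ∀ i j, B (e i) (e j) = if i = j then 1 else 0 := by
  have : FiniteDimensional ℝ V := Module.finite_of_finrank_pos (by omega)
  obtain ⟨b, hb⟩ := LinearMap.BilinForm.exists_orthogonal_basis (B := B) ⟨hs⟩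
  let c := b.reindex (finCongr hV)
  have hc : ∀ i j, i ≠ j → B (c i) (c j) = 0 := fun i j hij => by
    simp only [c, Module.Basis.reindex_apply]
    exact hb (fun h => hij ((finCongr hV).symm.injective h))
  refine ⟨fun i => (Real.sqrt (B (c i) (c i)))⁻¹ • c i, fun i j => ?_⟩
  simp only [map_smul, LinearMap.smul_apply, smul_eq_mul]
  split_ifs with h
  · subst h
    have h0 := hp (c i) (c.ne_zero i)
    have h1 := Real.mul_self_sqrt h0.le
    have h2 : Real.sqrt (B (c i) (c i)) ≠ 0 := (Real.sqrt_pos.2 h0).ne'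
    field_simp
    rw [sq, h1]
  · rw [hc i j h]
    simp

theorem eq_sum_of_orthonormal_three (hV : Module.finrank ℝ V = 3) (B : LinearMap.BilinForm ℝ V)
    {e : Fin 3 → V} (he : ∀ i j, B (e i) (e j) = if i = j then 1 else 0) (v : V) :
    v = B (e 0) v • e 0 + B (e 1) v • e 1 + B (e 2) v • e 2 := by
  have hli : LinearIndependent ℝ e := by
    rw [Fintype.linearIndependent_iff]
    intro g hg i
    have := congrArg (B (e i)) hg
    simpa [map_sum, he] using this
  let b := basisOfLinearIndependentOfCardEqFinrank hli (by simp [hV])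
  have hb : ∀ i, b i = e i := fun i => by simp [b]
  have h := b.sum_repr v
  simp only [hb, Fin.sum_univ_three] at h
  have hc (i) : B (e i) v = b.repr v i := by
    conv_lhs => rw [← h]
    simp only [map_add, map_smul, he, smul_eq_mul]
    fin_cases i <;> simp
  rw [hc, hc, hc, h]

variable [TopologicalSpace V]

/-- Euclidean content of the metric description: if `T` is the unit vector dual to `ω`, then
`ι_T A` is the only covector `ζ ⊥ ω` such that `A - ω ∧ ζ` is orthogonal to `ω ∧ ω^⊥`. -/
theorem projection_iff_eq_altInterior (hV : Module.finrank ℝ V = 3) (B : LinearMap.BilinForm ℝ V)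
    (hs : ∀ v w, B v w = B w v) (hp : ∀ v, v ≠ 0 → 0 < B v v) (T : V)
    (ω ζ : V [⋀^Fin 1]→L[ℝ] ℝ) (A : V [⋀^Fin 2]→L[ℝ] ℝ) (hω : ∀ v, ω ![v] = B T v)
    (hT : ω ![T] = 1) :
    ((∀ e : Fin 3 → V, (∀ i j, B (e i) (e j) = if i = j then 1 else 0) →
        ∑ i : Fin 1 → Fin 3, ζ (fun a => e (i a)) * ω (fun a => e (i a)) = 0) ∧
      ∀ θ : V [⋀^Fin 1]→L[ℝ] ℝ,
        (∀ e : Fin 3 → V, (∀ i j, B (e i) (e j) = if i = j then 1 else 0) →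
          ∑ i : Fin 1 → Fin 3, θ (fun a => e (i a)) * ω (fun a => e (i a)) = 0) →
        ∀ e : Fin 3 → V, (∀ i j, B (e i) (e j) = if i = j then 1 else 0) →
          ∑ i : Fin 2 → Fin 3, (A - altWedge ω ζ) (fun a => e (i a)) *
            altWedge ω θ (fun a => e (i a)) = 0) ↔ ζ = altInterior T A := by
  have hTe {e : Fin 3 → V} (he : ∀ i j, B (e i) (e j) = if i = j then 1 else 0) :
      T = ω ![e 0] • e 0 + ω ![e 1] • e 1 + ω ![e 2] • e 2 := by
    simp only [hω, hs T]
    exact eq_sum_of_orthonormal_three hV B he T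
  have hlin (γ : V [⋀^Fin 1]→L[ℝ] ℝ) (a b c : ℝ) (u v w : V) :
      γ ![a • u + b • v + c • w] = a * γ ![u] + b * γ ![v] + c * γ ![w] := by
    simp only [ContinuousAlternatingMap.vecCons_add, ContinuousAlternatingMap.vecCons_smul,
      smul_eq_mul]
  have hunit {e : Fin 3 → V} (he : ∀ i j, B (e i) (e j) = if i = j then 1 else 0) :
      ω ![e 0] ^ 2 + ω ![e 1] ^ 2 + ω ![e 2] ^ 2 = 1 := by
    have h := hT
    rw [hTe he, hlin] at h
    linear_combination h
  -- Since `T` is metrically dual to `ω`, orthogonality to `ω` means vanishing on `T`.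
  have hval (γ : V [⋀^Fin 1]→L[ℝ] ℝ) {e : Fin 3 → V}
      (he : ∀ i j, B (e i) (e j) = if i = j then 1 else 0) :
      ∑ i : Fin 1 → Fin 3, γ (fun a => e (i a)) * ω (fun a => e (i a)) = γ ![T] := by
    rw [sum_fin_one_family (fun f => γ f * ω f)]
    conv_rhs => rw [hTe he, hlin]
    ring
  have hint (v : V) : altInterior T A ![v] = A ![T, v] := rfl
  have hintT : altInterior T A ![T] = 0 := alt_two_self A T
  -- The factor 2 comes from summing over ordered pairs of indices. The pairing of `ω ∧ ζ` with `ω ∧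
  -- θ` is `2(|ω|²⟨ζ, θ⟩ - ⟨ω, θ⟩⟨ω, ζ⟩)`, which simplifies by `|ω| = 1` and `⟨ω, ζ⟩ = ζ(T) = 0`.
  have hmain (ζ θ : V [⋀^Fin 1]→L[ℝ] ℝ) (hζ : ζ ![T] = 0) (hθ : θ ![T] = 0) {e : Fin 3 → V}
      (he : ∀ i j, B (e i) (e j) = if i = j then 1 else 0) :
      ∑ i : Fin 2 → Fin 3, (A - altWedge ω ζ) (fun a => e (i a)) *
            altWedge ω θ (fun a => e (i a)) =
        2 * ((altInterior T A ![e 0] - ζ ![e 0]) * θ ![e 0] +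
          (altInterior T A ![e 1] - ζ ![e 1]) * θ ![e 1] +
          (altInterior T A ![e 2] - ζ ![e 2]) * θ ![e 2]) := by
    rw [sum_fin_two_family (fun f => (A - altWedge ω ζ) f * altWedge ω θ f)]
    have hA (i j) : (A - altWedge ω ζ) ![e i, e j] =
        A ![e i, e j] - (ω ![e i] * ζ ![e j] - ω ![e j] * ζ ![e i]) := by
      rw [← altWedge_one_one]; rfl
    have hη (v : V) : A ![T, v] =
        ω ![e 0] * A ![e 0, v] + ω ![e 1] * A ![e 1, v] + ω ![e 2] * A ![e 2, v] := by
      conv_lhs => rw [hTe he]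
      simp only [ContinuousAlternatingMap.vecCons_add, ContinuousAlternatingMap.vecCons_smul,
        smul_eq_mul]
    rw [hTe he, hlin] at hζ hθ
    simp only [Fin.sum_univ_three, hA, hint, hη, altWedge_one_one, alt_two_self]
    rw [alt_two_swap A (e 0) (e 1), alt_two_swap A (e 0) (e 2), alt_two_swap A (e 1) (e 2)]
    have hu := hunit he
    generalize A ![e 0, e 1] = a01, A ![e 0, e 2] = a02, A ![e 1, e 2] = a12,
      ω ![e 0] = t0, ω ![e 1] = t1, ω ![e 2] = t2, ζ ![e 0] = z0, ζ ![e 1] = z1, ζ ![e 2] = z2,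
      θ ![e 0] = s0, θ ![e 1] = s1, θ ![e 2] = s2 at *
    linear_combination (-2 * (z0 * s0 + z1 * s1 + z2 * s2)) * hu +
      (2 * (t0 * s0 + t1 * s1 + t2 * s2)) * hζ
  constructor
  · rintro ⟨h1, h2⟩
    obtain ⟨e, he⟩ := exists_orthonormal_three hV B hs hp
    have hζ : ζ ![T] = 0 := by rw [← hval ζ he]; exact h1 e he
    have hθ : (altInterior T A - ζ) ![T] = 0 := by
      change altInterior T A ![T] - ζ ![T] = 0
      rw [hintT, hζ, sub_zero]
    -- Testing against the difference itself yields a vanishing sum of three squares.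
    have h3 := h2 (altInterior T A - ζ) (fun e' he' => by rw [hval _ he', hθ]) e he
    rw [hmain ζ _ hζ hθ he] at h3
    have hsub (v : V) : (altInterior T A - ζ) ![v] = altInterior T A ![v] - ζ ![v] := rfl
    simp only [hsub] at h3
    have k0 : altInterior T A ![e 0] - ζ ![e 0] = 0 := by nlinarith
    have k1 : altInterior T A ![e 1] - ζ ![e 1] = 0 := by nlinarith
    have k2 : altInterior T A ![e 2] - ζ ![e 2] = 0 := by nlinarith
    ext v
    rw [eq_vec_one v, eq_sum_of_orthonormal_three hV B he (v 0), hlin, hlin]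
    linear_combination -(B (e 0) (v 0)) * k0 - (B (e 1) (v 0)) * k1 - (B (e 2) (v 0)) * k2
  · rintro rfl
    refine ⟨fun e he => by rw [hval _ he, hintT], fun θ hθ e he => ?_⟩
    rw [hmain _ θ hintT (by rw [← hval θ he]; exact hθ e he) he]
    ring

end Orthonormal

/-! ### The metric characterisation of `η` on the manifold. -/

section Metric

variable {M : Type*} [TopologicalSpace M] [ChartedSpace R3 M] [IsManifold 𝓘(ℝ, R3) ∞ M]

theorem Metric3.isProjectionForm_iff (g : Metric3 M) {ω : DForm R3 M 1} {T : VField R3 M}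
    (hg : g.IsCompatible ω T) (h1 : ∀ x, ω.pair T x = 1) (ζ : DForm R3 M 1) :
    g.IsProjectionForm ω ζ ↔ ζ = gvForm ω T := by
  have hx (x : M) := projection_iff_eq_altInterior (V := TangentSpace 𝓘(ℝ, R3) x)
    (show Module.finrank ℝ R3 = 3 by simp)
    (LinearMap.mk₂ ℝ (fun v w => g.inner x v w)
      (fun v v' w => congrArg (fun L => L w) (map_add (g.inner x) v v'))
      (fun c v w => congrArg (fun L => L w) (map_smul (g.inner x) c v))
      (fun v w w' => map_add (g.inner x v) w w') (fun c v w => map_smul (g.inner x v) c w)) (g.symm x) (g.pos x) (T x)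
    (ω x) (ζ x) (ω.d x) (hg x) (h1 x)
  rw [funext_iff]
  exact forall_congr' hx

end Metric

/-! ### Change of `η` and of `η ∧ dη`. -/

section Transformation

variable {M : Type*} [TopologicalSpace M] [ChartedSpace R3 M]

theorem DForm.ext_one {α β : DForm R3 M 1} (h : ∀ x v, α.coeff x ![v] = β.coeff x ![v]) :
    α = β := by
  funext x
  ext v
  rw [eq_vec_one v]
  exact h x _

variable [IsManifold 𝓘(ℝ, R3) ∞ M]

/-- The change of `η ∧ dη` under `η ↦ η + β`. -/
theorem wedge_d_add {η β : DForm R3 M 1} (hη : η.IsSmooth) (hβ : β.IsSmooth) :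
    (η + β).wedge (η + β).d = η.wedge η.d - DForm.d (η.wedge β)
      + (2 : ℝ) • (η.d.wedge β : DForm R3 M 3) + β.wedge β.d := by
  rw [DForm.d_add hη hβ, DForm.d_wedge_one_one hη hβ]
  refine DForm.ext_three fun x u v w => ?_
  change altWedge (η.coeff x + β.coeff x) (η.d.coeff x + β.d.coeff x) ![u, v, w] =
    altWedge (η.coeff x) (η.d.coeff x) ![u, v, w]
    - (altWedge (η.d.coeff x) (β.coeff x) ![u, v, w]
      - altWedge (η.coeff x) (β.d.coeff x) ![u, v, w])
    + 2 * altWedge (η.d.coeff x) (β.coeff x) ![u, v, w]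
    + altWedge (β.coeff x) (β.d.coeff x) ![u, v, w]
  simp only [altWedge_one_two, altWedge_two_one, ContinuousAlternatingMap.add_apply]
  ring

/-- The change of `η ∧ dη` under `η ↦ η - df + h ω`. -/
theorem wedge_d_sub_funDiff_add {η ω : DForm R3 M 1} {f h : M → ℝ} (hη : η.IsSmooth)
    (hω : ω.IsSmooth) (hf : ContMDiff 𝓘(ℝ, R3) 𝓘(ℝ, ℝ) ∞ f)
    (hh : ContMDiff 𝓘(ℝ, R3) 𝓘(ℝ, ℝ) ∞ h) :
    (η - funDiff f + DForm.mulFun h ω).wedge (η - funDiff f + DForm.mulFun h ω).d =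
      η.wedge η.d
        + DForm.d (-DForm.mulFun f η.d - DForm.mulFun f (DForm.mulFun h ω).d
            + DForm.mulFun h (ω.wedge η) : DForm R3 M 2)
        + DForm.mulFun (fun x => 2 * h x) (ω.wedge η.d)
        + DForm.mulFun (fun x => h x ^ 2) (ω.wedge ω.d) := by
  have hf' := hf.smoothInCharts
  have hh' := hh.smoothInCharts
  -- Write `κ = hω`. The cross terms satisfy `η ∧ dκ + κ ∧ dη = d(κ ∧ η) + 2 κ ∧ dη`, while `-df ∧
  -- dη` and `-df ∧ dκ` are the differentials of `-f dη` and `-f dκ`.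
  have hκ : (DForm.mulFun h ω).IsSmooth := hω.mulFun hh'
  have hwe : DForm.mulFun h (ω.wedge η) = (DForm.mulFun h ω).wedge η := by
    refine DForm.ext_two fun x u v => ?_
    change h x * altWedge (ω.coeff x) (η.coeff x) ![u, v] =
      altWedge (h x • ω.coeff x) (η.coeff x) ![u, v]
    simp only [altWedge_one_one, ContinuousAlternatingMap.smul_apply, smul_eq_mul]
    ring
  rw [hwe, DForm.d_add (hη.sub (funDiff_isSmooth hf)) hκ, DForm.d_sub hη (funDiff_isSmooth hf),
    d_funDiff hf, sub_zero,
    DForm.d_add ((hη.d.mulFun hf').neg.sub (hκ.d.mulFun hf')) (hκ.wedge_one_one hη),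
    DForm.d_sub (hη.d.mulFun hf').neg (hκ.d.mulFun hf'), DForm.d_neg,
    DForm.d_mulFun_two hf hη.d, DForm.d_mulFun_two hf hκ.d, hη.d_d, hκ.d_d,
    DForm.d_wedge_one_one hκ hη, DForm.d_mulFun_one hh hω]
  refine DForm.ext_three fun x u v w => ?_
  set ξ : R3 [⋀^Fin 1]→L[ℝ] ℝ := DForm.coeff (funDiff f) x
  set τ : R3 [⋀^Fin 1]→L[ℝ] ℝ := DForm.coeff (funDiff h) x
  set a : R3 [⋀^Fin 1]→L[ℝ] ℝ := η.coeff x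
  set o : R3 [⋀^Fin 1]→L[ℝ] ℝ := ω.coeff x
  set da : R3 [⋀^Fin 2]→L[ℝ] ℝ := η.d.coeff x
  set dω : R3 [⋀^Fin 2]→L[ℝ] ℝ := ω.d.coeff x
  set p : R3 [⋀^Fin 2]→L[ℝ] ℝ := altWedge τ o with hp
  -- The terms `f x * 0` are `f d(dη)` and `f d(dκ)`.
  change altWedge (a - ξ + h x • o) (da + (p + h x • dω)) ![u, v, w] =
    altWedge a da ![u, v, w]
    + (-(altWedge ξ da ![u, v, w] + f x * 0) - (altWedge ξ (p + h x • dω) ![u, v, w] + f x * 0)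
      + (altWedge (p + h x • dω) a ![u, v, w] - altWedge (h x • o) da ![u, v, w]))
    + 2 * h x * altWedge o da ![u, v, w] + h x ^ 2 * altWedge o dω ![u, v, w]
  simp only [altWedge_one_two, altWedge_two_one, ContinuousAlternatingMap.add_apply,
    ContinuousAlternatingMap.sub_apply, ContinuousAlternatingMap.smul_apply, smul_eq_mul]
  -- Expanding `dh ∧ ω` lets `ω ∧ dh ∧ ω` cancel, so that `κ ∧ dκ` reduces to `h² ω ∧ dω`.
  simp only [hp, altWedge_one_one]
  ring

theorem DForm.IsSmooth.gvForm {ω : DForm R3 M 1} {T : VField R3 M} (hω : ω.IsSmooth)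
    (hT : T.IsSmooth) : (gvForm ω T).IsSmooth := hω.d.interior hT

theorem contMDiff_deriv {T : VField R3 M} (hT : T.IsSmooth) {f : M → ℝ}
    (hf : ContMDiff 𝓘(ℝ, R3) 𝓘(ℝ, ℝ) ∞ f) : ContMDiff 𝓘(ℝ, R3) 𝓘(ℝ, ℝ) ∞ (T.deriv f) :=
  ((funDiff_isSmooth hf).pair hT).contMDiff

theorem coeff_funDiff_exp {f : M → ℝ} (hf : ContMDiff 𝓘(ℝ, R3) 𝓘(ℝ, ℝ) ∞ f) (x : M) (v : R3) :
    DForm.coeff (funDiff fun p => Real.exp (f p)) x ![v] =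
      Real.exp (f x) * DForm.coeff (funDiff f) x ![v] := by
  have he : ContMDiff 𝓘(ℝ, R3) 𝓘(ℝ, ℝ) ∞ fun p => Real.exp (f p) :=
    Real.contDiff_exp.contMDiff.comp hf
  rw [coeff_funDiff he, coeff_funDiff hf,
    fderiv_exp (hf.differentiableAt_comp_chart_symm x),
    (chartAt R3 x).left_inv (mem_chart_source R3 x)]
  rfl

/-- The change of `η` under a rescaling of the pair `(ω, T)`. -/
theorem gvForm_rescale {ω : DForm R3 M 1} {T : VField R3 M} (hω : ω.IsSmooth)
    (h1 : ∀ x, ω.pair T x = 1) {f : M → ℝ} (hf : ContMDiff 𝓘(ℝ, R3) 𝓘(ℝ, ℝ) ∞ f) :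
    gvForm (DForm.mulFun (fun x => Real.exp (f x)) ω) (fun x => Real.exp (-f x) • T x) =
      gvForm ω T - funDiff f + DForm.mulFun (T.deriv f) ω := by
  have he : ContMDiff 𝓘(ℝ, R3) 𝓘(ℝ, ℝ) ∞ fun x => Real.exp (f x) :=
    Real.contDiff_exp.contMDiff.comp hf
  rw [gvForm, DForm.d_mulFun_one he hω]
  refine DForm.ext_one fun x v => ?_
  set t : R3 := T x
  change (altWedge (DForm.coeff (funDiff fun p => Real.exp (f p)) x) (ω.coeff x)
      + Real.exp (f x) • ω.d.coeff x) ![Real.exp (-f x) • t, v] =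
    ω.d.coeff x ![t, v] - DForm.coeff (funDiff f) x ![v]
      + DForm.coeff (funDiff f) x ![t] * ω.coeff x ![v]
  have hT : ω.coeff x ![t] = 1 := h1 x
  -- Contracting `df ∧ ω` with `T` gives `T(f) ω - df` because `ω(T) = 1`; the factors `exp (f x)`
  -- and `exp (-f x)` cancel.
  rw [ContinuousAlternatingMap.vecCons_smul, ContinuousAlternatingMap.add_apply,
    ContinuousAlternatingMap.smul_apply, altWedge_one_one, coeff_funDiff_exp hf,
    coeff_funDiff_exp hf, hT, Real.exp_neg]
  have := Real.exp_ne_zero (f x)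
  simp only [smul_eq_mul]
  field_simp
  ring

end Transformation
theorem mainTheorem4 {M : Type*} [TopologicalSpace M] [T2Space M] [CompactSpace M]
    [ChartedSpace (EuclideanSpace ℝ (Fin 3)) M] [IsManifold (𝓡 3) ∞ M]
    (ω ω' : DForm R3 M 1) (T T' : VField R3 M)
    (hω : ω.IsSmooth) (hω' : ω'.IsSmooth) (hT : T.IsSmooth) (hT' : T'.IsSmooth)
    (h1 : ∀ x, ω.pair T x = 1) (h1' : ∀ x, ω'.pair T' x = 1) :
    -- `ι_T dω` is the form `η` defined by orthogonal projection, for every compatible metric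
    (∀ g : Metric3 M, g.IsCompatible ω T →
      ∀ ζ : DForm R3 M 1, g.IsProjectionForm ω ζ ↔ ζ = gvForm ω T) ∧
    -- (i)
    (∀ f : M → ℝ, ContMDiff (𝓡 3) 𝓘(ℝ, ℝ) ∞ f →
      (∀ x, T' x = Real.exp (-f x) • T x) →
      (∀ x, ∃ c : ℝ, ω' x = c • ω x) →
      ω' = DForm.mulFun (fun x => Real.exp (f x)) ω ∧
      gvForm ω' T' = gvForm ω T - funDiff f + DForm.mulFun (T.deriv f) ω ∧
      (gvForm ω' T').wedge (gvForm ω' T').d =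
        (gvForm ω T).wedge (gvForm ω T).d
        + DForm.d (-DForm.mulFun f (gvForm ω T).d
            - DForm.mulFun f (DForm.mulFun (T.deriv f) ω).d
            + DForm.mulFun (T.deriv f) (ω.wedge (gvForm ω T)) : DForm R3 M 2)
        + DForm.mulFun (fun x => 2 * T.deriv f x) (ω.wedge (gvForm ω T).d)
        + DForm.mulFun (fun x => T.deriv f x ^ 2) (ω.wedge ω.d)) ∧
    -- (ii)
    (∀ X : VField R3 M, X.IsSmooth → (∀ x, ω.pair X x = 0) →
      (∀ x, T' x = T x + X x) → ω' = ω →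
      gvForm ω' T' = gvForm ω T + ω.d.interior X ∧
      (gvForm ω' T').wedge (gvForm ω' T').d =
        (gvForm ω T).wedge (gvForm ω T).d
        - DForm.d ((gvForm ω T).wedge (ω.d.interior X))
        + (2 : ℝ) • ((gvForm ω T).d.wedge (ω.d.interior X) : DForm R3 M 3)
        + (ω.d.interior X).wedge (ω.d.interior X).d) ∧
    -- (iii)
    (∀ μ : DForm R3 M 1, μ.IsSmooth → T' = T → ω' = ω + μ →
      (∀ x, μ.pair T x = 0) ∧
      gvForm ω' T' = gvForm ω T + μ.d.interior T ∧
      (gvForm ω' T').wedge (gvForm ω' T').d =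
        (gvForm ω T).wedge (gvForm ω T).d
        - DForm.d ((gvForm ω T).wedge (μ.d.interior T))
        + (2 : ℝ) • ((gvForm ω T).d.wedge (μ.d.interior T) : DForm R3 M 3)
        + (μ.d.interior T).wedge (μ.d.interior T).d) := by
  refine ⟨fun g hg ζ => g.isProjectionForm_iff hg h1 ζ, ?_, ?_, ?_⟩
  · intro f hf hT'T hω'ω
    obtain rfl : T' = fun x => Real.exp (-f x) • T x := funext hT'T
    have hexp : ω' = DForm.mulFun (fun x => Real.exp (f x)) ω := by
      funext x
      obtain ⟨c, hc⟩ := hω'ω x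
      have h := h1' x
      have h0 := h1 x
      simp only [DForm.pair] at h h0
      rw [hc, ContinuousAlternatingMap.smul_apply, ContinuousAlternatingMap.vecCons_smul, h0,
        Real.exp_neg] at h
      have hne := Real.exp_ne_zero (f x)
      -- The normalisation `ω'(T') = 1` reads `c * exp (-f x) = 1`.
      have hcx : c = Real.exp (f x) := by
        simp only [smul_eq_mul] at h
        field_simp at h
        exact h
      rw [hc, hcx]
      rfl
    subst hexp
    have hη := gvForm_rescale hω h1 hf
    refine ⟨rfl, hη, ?_⟩
    rw [hη]
    exact wedge_d_sub_funDiff_add (hω.gvForm hT) hω hf (contMDiff_deriv hT hf)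
  · intro X hX _ hT'T hω'ω
    subst hω'ω
    have hη : gvForm ω' T' = gvForm ω' T + ω'.d.interior X := by
      refine DForm.ext_one fun x v => ?_
      have h : T' x = T x + X x := hT'T x
      change ω'.d x ![T' x, v] = ω'.d x ![T x, v] + ω'.d x ![X x, v]
      rw [h, ContinuousAlternatingMap.vecCons_add]
    refine ⟨hη, ?_⟩
    rw [hη]
    exact wedge_d_add (hω.gvForm hT) (hω.d.interior hX)
  · intro μ hμ hT'T hω'ω
    subst hT'T hω'ω
    have hη : gvForm (ω + μ) T' = gvForm ω T' + μ.d.interior T' := by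
      rw [gvForm, DForm.d_add hω hμ]
      rfl
    refine ⟨fun x => ?_, hη, ?_⟩
    · have h := h1' x
      have h0 := h1 x
      change ω x ![T' x] + μ x ![T' x] = 1 at h
      change ω x ![T' x] = 1 at h0
      change μ x ![T' x] = 0
      linarith
    · rw [hη]
      exact wedge_d_add (hω.gvForm hT) (hμ.d.interior hT)
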